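/- Let $k$ be a field and let $\mathcal{C}$ be a $k$-linear Reedy category. That is, $\mathcal{C}$ is a small $k$-linear category with a degree function $\deg\colon \mathrm{Obj}(\mathcal{C})\to\lambda$ to an ordinal $\lambda$ and two $k$-linear subcategories $\mathcal{C}^+,\mathcal{C}^-$ having the same objects as $\mathcal{C}$, such that for all objects $c,d$: - $\mathcal{C}^+(c,c)\cong k\cong\mathcal{C}^-(c,c)$ as $k$-vector spaces; if $c\neq d$ and $\mathcal{C}^+(c,d)\neq 0$ then $\deg(c)<\deg(d)$; if $c\ne d$ and $\mathcal{C}^-(c,d)\neq 0$ then $\deg(c)>\deg(d)$; - composition induces a $k$-linear isomorphism $\bigoplus_{e\in\mathrm{Obj}(\mathcal{C})}\mathcal{C}^+(e,d)\otimes_k\mathcal{C}^-(c,e)\to\mathcal{C}(c,d)$. A left $\mathcal{C}$-module is a $k$-linear functor from $\mathcal{C}$ to $k$-vector spaces. For an ordinal $\alpha$ let $\mathcal{I}_{<\alpha}(c,d)\subseteq\mathcal{C}(c,d)$ be the image of $\bigoplus_{\deg(e)<\alpha}\mathcal{C}^+(e,d)\otimes_k\mathcal{C}^-(c,e)$ under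 composition. The standard left $\mathcal{C}$-module of an object $c$ is $\Delta_c:=\mathcal{C}(c,-)/\mathcal{I}_{<\deg(c)}(c,-)$. A left $\mathcal{C}$-module $M$ is filtered by standard modules if for some ordinal $\sigma$ there is a direct system $(M_\alpha)_{\alpha\leq\sigma}$ of left $\mathcal{C}$-modules with $M_0=0$ and $M_\sigma\cong M$, with $M_\beta=\varinjlim_{\alpha<\beta}M_\alpha$ for every limit ordinal $\beta\leq\sigma$, and such that for every $\alpha<\sigma$ the map $M_\alpha\to M_{\alpha+1}$ is a monomorphism whose cokernel is isomorphic to $\Delta_c$ for some object $c$ of $\mathcal{C}$. If a left $\mathcal{C}$-module $M$ is filtered by standard modules, then every direct summand of $M$ is filtered by standard modules. -/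

import Mathlib

open CategoryTheory CategoryTheory.Limits
open scoped TensorProduct

universe u

/-- A wide `k`-linear subcategory (all objects of `C`) of a `k`-linear category `C`: a subspace of
every morphism space, containing the identities and closed under composition. -/
structure WideLinearSubcategory (k : Type u) [Field k] (C : Type u) [SmallCategory C]
    [Preadditive C] [Linear k C] where
  hom : ∀ c d : C, Submodule k (c ⟶ d)
  id_mem : ∀ c : C, 𝟙 c ∈ hom c c
  comp_mem : ∀ {c d e : C} (f : c ⟶ d) (g : d ⟶ e),
    f ∈ hom c d → g ∈ hom d e → f ≫ g ∈ hom c e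

/-- The subcategory `H` is direct with respect to `deg`: endomorphism spaces are isomorphic to `k`,
and nonzero non-endomorphisms strictly raise the degree. -/
structure WideLinearSubcategory.IsDirect {k : Type u} [Field k] {C : Type u} [SmallCategory C]
    [Preadditive C] [Linear k C] (H : WideLinearSubcategory k C) (deg : C → Ordinal.{u}) :
    Prop where
  nonempty_end_equiv : ∀ c : C, Nonempty (H.hom c c ≃ₗ[k] k)
  deg_lt_deg : ∀ {c d : C} (f : c ⟶ d), f ∈ H.hom c d → f ≠ 0 → c ≠ d → deg c < deg d

/-- The subcategory `H` is inverse with respect to `deg`: endomorphism spaces are isomorphic to `k`,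
and nonzero non-endomorphisms strictly lower the degree. -/
structure WideLinearSubcategory.IsInverse {k : Type u} [Field k] {C : Type u} [SmallCategory C]
    [Preadditive C] [Linear k C] (H : WideLinearSubcategory k C) (deg : C → Ordinal.{u}) :
    Prop where
  nonempty_end_equiv : ∀ c : C, Nonempty (H.hom c c ≃ₗ[k] k)
  deg_lt_deg : ∀ {c d : C} (f : c ⟶ d), f ∈ H.hom c d → f ≠ 0 → c ≠ d → deg d < deg c

/-- The composition map `P(e,d) ⊗ N(c,e) → C(c,d)`, `h ⊗ g ↦ h ∘ g`, for two wide linear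
subcategories `P` and `N`. -/
noncomputable def factorizationMap {k : Type u} [Field k] {C : Type u} [SmallCategory C]
    [Preadditive C] [Linear k C] (P N : WideLinearSubcategory k C) (c d e : C) :
    (P.hom e d) ⊗[k] (N.hom c e) →ₗ[k] (c ⟶ d) :=
  TensorProduct.lift
    (LinearMap.domRestrict₁₂ (Linear.comp (S := k) c e d).flip (P.hom e d) (N.hom c e))

open Classical in
/-- A `k`-linear Reedy structure on a small `k`-linear category `C`. -/
structure LinearReedyStructure (k : Type u) [Field k] (C : Type u) [SmallCategory C]
    [Preadditive C] [Linear k C] where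
  /-- the ordinal bounding the degrees -/
  lam : Ordinal.{u}
  /-- the degree function -/
  deg : C → Ordinal.{u}
  deg_lt : ∀ c : C, deg c < lam
  /-- the direct subcategory -/
  plus : WideLinearSubcategory k C
  /-- the inverse subcategory -/
  minus : WideLinearSubcategory k C
  plus_isDirect : plus.IsDirect deg
  minus_isInverse : minus.IsInverse deg
  /-- composition induces an isomorphism `⨁ₑ C⁺(e,d) ⊗ C⁻(c,e) ≅ C(c,d)` -/
  bijective_factorization : ∀ c d : C, Function.Bijective
    (DirectSum.toModule k C (c ⟶ d) (fun e => factorizationMap plus minus c d e))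

/-- Left `C`-modules: the category of `k`-linear functors from `C` to `k`-vector spaces, as a full
subcategory of the category of all functors. -/
abbrev LeftModules (k : Type u) [Field k] (C : Type u) [SmallCategory C]
    [Preadditive C] [Linear k C] : Type (u + 1) :=
  ObjectProperty.FullSubcategory
    (fun F : C ⥤ ModuleCat.{u} k => F.Additive ∧ F.Linear k)

namespace LinearReedyStructure

open Classical in
/-- The subspace `I_{<α}(c,d)` of `C(c,d)`: the image of
`⨁_{deg e < α} C⁺(e,d) ⊗ C⁻(c,e) → C(c,d)`. -/
noncomputable def idealLT {k : Type u} [Field k] {C : Type u} [SmallCategory C]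
    [Preadditive C] [Linear k C] (R : LinearReedyStructure k C) (α : Ordinal.{u}) (c d : C) :
    Submodule k (c ⟶ d) :=
  LinearMap.range (DirectSum.toModule k {e : C // R.deg e < α} (c ⟶ d)
    (fun e => factorizationMap R.plus R.minus c d e.1))

theorem idealLT_eq_span {k : Type u} [Field k] {C : Type u} [SmallCategory C]
    [Preadditive C] [Linear k C] (R : LinearReedyStructure k C) (α : Ordinal.{u}) (c d : C) :
    R.idealLT α c d = Submodule.span k {f : c ⟶ d | ∃ e : C, R.deg e < α ∧
      ∃ g ∈ R.minus.hom c e, ∃ h ∈ R.plus.hom e d, g ≫ h = f} := by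
  classical
  apply le_antisymm
  · rintro _ ⟨x, rfl⟩
    induction x using DirectSum.induction_on with
    | zero => simp
    | add x y hx hy => rw [map_add]; exact Submodule.add_mem _ hx hy
    | of e t =>
      rw [← DirectSum.lof_eq_of k, DirectSum.toModule_lof]
      induction t using TensorProduct.induction_on with
      | zero => simp
      | add x y hx hy => rw [map_add]; exact Submodule.add_mem _ hx hy
      | tmul h g =>
        exact Submodule.subset_span ⟨e.1, e.2, g.1, g.2, h.1, h.2, rfl⟩
  · rw [Submodule.span_le]
    rintro _ ⟨e, he, g, hg, h, hh, rfl⟩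
    exact ⟨DirectSum.lof k {e : C // R.deg e < α}
      (fun e => (R.plus.hom e.1 d) ⊗[k] (R.minus.hom c e.1)) ⟨e, he⟩
      ((⟨h, hh⟩ : R.plus.hom e d) ⊗ₜ[k] (⟨g, hg⟩ : R.minus.hom c e)),
      DirectSum.toModule_lof k _ _⟩

/-- Every morphism is a sum of composites of a morphism in `C⁻` followed by one in `C⁺`. -/
theorem mem_span_factorization {k : Type u} [Field k] {C : Type u} [SmallCategory C]
    [Preadditive C] [Linear k C] (R : LinearReedyStructure k C) {c d : C} (f : c ⟶ d) :
    f ∈ Submodule.span k {f : c ⟶ d | ∃ e : C,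
      ∃ g ∈ R.minus.hom c e, ∃ h ∈ R.plus.hom e d, g ≫ h = f} := by
  classical
  obtain ⟨x, rfl⟩ := (R.bijective_factorization c d).2 f
  induction x using DirectSum.induction_on with
  | zero => simp
  | add x y hx hy => rw [map_add]; exact Submodule.add_mem _ hx hy
  | of e t =>
    rw [← DirectSum.lof_eq_of k, DirectSum.toModule_lof]
    induction t using TensorProduct.induction_on with
    | zero => simp
    | add x y hx hy => rw [map_add]; exact Submodule.add_mem _ hx hy
    | tmul h g => exact Submodule.subset_span ⟨e, g.1, g.2, h.1, h.2, rfl⟩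

/-- `I_{<α}(c,-)` is stable under postcomposition. -/
theorem comp_mem_idealLT {k : Type u} [Field k] {C : Type u} [SmallCategory C]
    [Preadditive C] [Linear k C] (R : LinearReedyStructure k C) (α : Ordinal.{u}) {c d d' : C}
    (f : c ⟶ d) (hf : f ∈ R.idealLT α c d) (g : d ⟶ d') : f ≫ g ∈ R.idealLT α c d' := by
  rw [idealLT_eq_span] at hf ⊢
  induction hf using Submodule.span_induction with
  | zero => simp
  | add x y _ _ hx hy => rw [Preadditive.add_comp]; exact Submodule.add_mem _ hx hy
  | smul a x _ hx => rw [Linear.smul_comp]; exact Submodule.smul_mem _ a hx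
  | mem x hx =>
    obtain ⟨e, he, p, hp, q, -, rfl⟩ := hx
    rw [Category.assoc]
    have hm := R.mem_span_factorization (q ≫ g)
    generalize q ≫ g = r at hm
    induction hm using Submodule.span_induction with
    | zero => simp
    | add x y _ _ hx hy => rw [Preadditive.comp_add]; exact Submodule.add_mem _ hx hy
    | smul a x _ hx => rw [Linear.comp_smul]; exact Submodule.smul_mem _ a hx
    | mem x hx =>
      obtain ⟨e', p', hp', q', hq', rfl⟩ := hx
      by_cases h0 : p' = 0
      · simp [h0]
      · have hdeg : R.deg e' < α := by
          by_cases hee : e = e'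
          · exact hee ▸ he
          · exact (R.minus_isInverse.deg_lt_deg p' hp' h0 hee).trans he
        exact Submodule.subset_span ⟨e', hdeg, p ≫ p', R.minus.comp_mem p p' hp hp', q', hq',
          by simp⟩

/-- The functor underlying the standard left module at `c`: the quotient of `C(c,-)` by
`I_{<deg c}(c,-)`. -/
noncomputable def standardFunctor {k : Type u} [Field k] {C : Type u} [SmallCategory C]
    [Preadditive C] [Linear k C] (R : LinearReedyStructure k C) (c : C) :
    C ⥤ ModuleCat.{u} k where
  obj d := ModuleCat.of k ((c ⟶ d) ⧸ R.idealLT (R.deg c) c d)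
  map {d d'} g := ModuleCat.ofHom (Submodule.mapQ (R.idealLT (R.deg c) c d)
    (R.idealLT (R.deg c) c d') (Linear.rightComp k c g)
    (fun f hf => R.comp_mem_idealLT (R.deg c) f hf g))
  map_id d := by
    apply ModuleCat.hom_ext
    refine Submodule.linearMap_qext _ (LinearMap.ext fun f => ?_)
    exact congrArg (Submodule.Quotient.mk (p := R.idealLT (R.deg c) c d)) (Category.comp_id f)
  map_comp {d d' d''} f g := by
    apply ModuleCat.hom_ext
    refine Submodule.linearMap_qext _ (LinearMap.ext fun h => ?_)
    exact congrArg (Submodule.Quotient.mk (p := R.idealLT (R.deg c) c d''))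
      (Category.assoc h f g).symm

/-- The standard left `C`-module `Δ_c`. -/
noncomputable def standard {k : Type u} [Field k] {C : Type u} [SmallCategory C]
    [Preadditive C] [Linear k C] (R : LinearReedyStructure k C) (c : C) : LeftModules k C where
  obj := R.standardFunctor c
  property := by
    constructor
    · refine ⟨fun {d d'} f g => ?_⟩
      apply ModuleCat.hom_ext
      refine Submodule.linearMap_qext _ (LinearMap.ext fun h => ?_)
      exact (congrArg (Submodule.Quotient.mk (p := R.idealLT (R.deg c) c d'))
        (Preadditive.comp_add _ _ _ h f g)).trans rfl
    · refine ⟨fun {d d'} f r => ?_⟩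
      apply ModuleCat.hom_ext
      refine Submodule.linearMap_qext _ (LinearMap.ext fun h => ?_)
      exact (congrArg (Submodule.Quotient.mk (p := R.idealLT (R.deg c) c d'))
        (Linear.comp_smul _ _ _ h r f)).trans rfl

/-- The class of all left `C`-modules isomorphic to some standard module `Δ_c`. -/
def standards {k : Type u} [Field k] {C : Type u} [SmallCategory C]
    [Preadditive C] [Linear k C] (R : LinearReedyStructure k C) :
    ObjectProperty (LeftModules k C) :=
  fun X => ∃ c : C, Nonempty (X ≅ R.standard c)

end LinearReedyStructure

/-- `M` is filtered by the class `X`: for some ordinal `σ` there is a direct system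
`(M_α)_{α ≤ σ}` with `M_0 = 0` and `M_σ ≅ M`, continuous (`M_β` is the colimit of the `M_α`, `α < β`,
for limit `β ≤ σ`), whose steps `M_α → M_{α+1}` are monomorphisms with cokernel in `X`. -/
def IsFilteredBy {A : Type (u + 1)} [LargeCategory.{u} A] [HasZeroMorphisms A]
    (X : ObjectProperty A) (M : A) : Prop :=
  ∃ (σ : Ordinal.{u}) (F : Set.Iic σ ⥤ A),
    F.IsWellOrderContinuous ∧
    IsZero (F.obj ⟨0, Set.mem_Iic.2 zero_le⟩) ∧
    Nonempty (F.obj ⟨σ, le_refl σ⟩ ≅ M) ∧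
    ∀ (α : Ordinal.{u}) (hα : α < σ),
      let i : F.obj ⟨α, hα.le⟩ ⟶ F.obj ⟨Order.succ α, Order.succ_le_of_lt hα⟩ :=
        F.map (homOfLE (Order.le_succ α))
      Mono i ∧ ∃ (Q : A) (p : F.obj ⟨Order.succ α, Order.succ_le_of_lt hα⟩ ⟶ Q) (w : i ≫ p = 0),
        X Q ∧ Nonempty (IsColimit (CokernelCofork.ofπ p w))

/-- `N` is a direct summand of `M`: `M ≅ N ⊕ N'` for some object `N'`. -/
def IsDirectSummand {A : Type (u + 1)} [LargeCategory.{u} A] [Preadditive A] (N M : A) : Prop :=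
  ∃ (N' : A) (b : BinaryBicone N N'), Nonempty b.IsBilimit ∧ Nonempty (b.pt ≅ M)

/-!
The proof compares a left `C`-module with its restriction to the direct subcategory `C⁺`.

By the factorization axiom, `C(c,d) = C⁺(c,d) ⊕ I_{<deg c}(c,d)`, so `Δ_c` restricts to the free
`C⁺`-module `C⁺(c,-)`. Hence a module filtered by standard modules restricts to a free `C⁺`-module:
lifts of the generators of the successive quotients form a basis
(`LinearReedyStructure.exists_isPlusBasis_of_chain`).

Conversely, a module `N` whose restriction to `C⁺` has a basis `y` is filtered by standard modules
(`LinearReedyStructure.IsPlusBasis.isFilteredBy`). Adjoin the basis elements one at a time in order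
of increasing degree. A morphism in `I_{<deg c}` carries a basis element at `c` through objects of
degree less than `deg c`, where `N` is generated by basis elements of smaller degree. So the
`C⁺`-span of an initial segment of the basis is a `C`-submodule, and each successive quotient is
generated by an element at `c` killed by `I_{<deg c}` and free over `C⁺`, that is, a copy of `Δ_c`.

It remains to see that a direct summand of a free `C⁺`-module is free. Call the span in `M(c)` of
all `h · y`, for `h` in `C⁺` not an endomorphism, the radical. Freeness implies that each functional
on `M(c)` vanishing on the radical extends to a `C⁺`-linear map `M → C⁺(c,-)`
(`LinearReedyStructure.LiftsFunctionals`), and this property clearly passes to retracts. It implies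
freeness in turn: lifts of bases of the quotients by the radical generate by induction on the
degree, and the maps extending the dual coordinate functionals show that they are independent
(`LinearReedyStructure.LiftsFunctionals.exists_isPlusBasis`).
-/

/-! ### Order and linear algebra -/

theorem Set.isSuccLimit_mk_Iic {σ β : Ordinal.{u}} (hβ : β ≤ σ) (h : Order.IsSuccLimit β) :
    Order.IsSuccLimit (⟨β, hβ⟩ : Set.Iic σ) := by
  refine ⟨fun hmin => h.1 ?_, fun a ha => h.2 a.1 ⟨ha.1, fun b hab hb => ?_⟩⟩
  · intro b hb
    exact hmin (b := ⟨b, hb.trans hβ⟩) hb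
  · exact ha.2 (c := ⟨b, hb.le.trans hβ⟩) hab hb

theorem Set.isSuccLimit_coe_Iic {σ : Ordinal.{u}} {m : Set.Iic σ} (h : Order.IsSuccLimit m) :
    Order.IsSuccLimit m.1 := by
  refine ⟨fun hmin => h.1 fun b hb => hmin hb, fun a ha => h.2 ⟨a, ha.1.le.trans m.2⟩ ⟨ha.1, ?_⟩⟩
  exact fun b hab hb => ha.2 (c := b.1) hab hb

/-- A family of ordinals indexed by a set can be listed in an order that is compatible with the
strict order of their values. -/
theorem Ordinal.exists_rank {J : Type u} (f : J → Ordinal.{u}) :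
    ∃ (σ : Ordinal.{u}) (ρ : J → Ordinal.{u}), Function.Injective ρ ∧ (∀ j, ρ j < σ) ∧
      (∀ α < σ, ∃ j, ρ j = α) ∧ ∀ i j, f i < f j → ρ i < ρ j := by
  -- Order `J` lexicographically: by the value of `f`, then by an arbitrary well-order.
  let r : J → J → Prop := (fun j => (f j, j)) ⁻¹'o Prod.Lex (· < ·) WellOrderingRel
  have hr : IsWellOrder J r := (RelEmbedding.preimage
    (⟨fun j => (f j, j), fun i j h => (Prod.ext_iff.1 h).2⟩ : J ↪ Ordinal.{u} × J)
    (Prod.Lex (· < ·) WellOrderingRel)).isWellOrder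
  refine ⟨Ordinal.type r, Ordinal.typein r, Ordinal.typein_injective r, Ordinal.typein_lt_type r,
    fun α hα => Ordinal.mem_range_typein_iff r |>.2 hα, fun i j hij => ?_⟩
  exact (Ordinal.typein_lt_typein r).2 (Prod.Lex.left _ _ hij)

/-- Compatible linear maps on a chain of subspaces glue to a linear map on their union. -/
theorem Submodule.exists_linearMap_of_chain {k V P ι : Type*} [Field k] [AddCommGroup V]
    [Module k V] [AddCommGroup P] [Module k P] [LinearOrder ι] {T : ι → Submodule k V}
    (hT : Monotone T) {U : Submodule k V} (hTU : ∀ i, T i ≤ U) (hU : ∀ x ∈ U, ∃ i, x ∈ T i)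
    (f : ∀ i, T i →ₗ[k] P)
    (hf : ∀ i j (hij : i ≤ j) (x : T i), f j (Submodule.inclusion (hT hij) x) = f i x) :
    ∃ g : U →ₗ[k] P, ∀ i (x : T i), g (Submodule.inclusion (hTU i) x) = f i x := by
  have hind : ∀ i j x (hi : x ∈ T i) (hj : x ∈ T j), f i ⟨x, hi⟩ = f j ⟨x, hj⟩ := by
    intro i j x hi hj
    rcases le_total i j with hij | hij
    · exact (hf i j hij ⟨x, hi⟩).symm
    · exact hf j i hij ⟨x, hj⟩
  choose n hn using fun x : U => hU x.1 x.2
  refine ⟨{ toFun := fun x => f (n x) ⟨x.1, hn x⟩, map_add' := fun x y => ?_,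
            map_smul' := fun a x => ?_ }, fun i x => hind _ _ _ _ _⟩
  · let m := max (n x) (n y)
    have hx : x.1 ∈ T m := hT (le_max_left _ _) (hn x)
    have hy : y.1 ∈ T m := hT (le_max_right _ _) (hn y)
    rw [hind _ m x.1 (hn x) hx, hind _ m y.1 (hn y) hy,
      hind _ m (x + y).1 (hn (x + y)) (add_mem hx hy), ← map_add]
    rfl
  · have hx : (a • x).1 ∈ T (n x) := Submodule.smul_mem _ a (hn x)
    rw [hind _ (n x) (a • x).1 (hn (a • x)) hx, RingHom.id_apply, ← map_smul]
    rfl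

/-- A linear map factors through any surjection whose kernel it kills. -/
theorem LinearMap.exists_comp_eq_of_ker_le {k V W U : Type*} [Field k] [AddCommGroup V]
    [Module k V] [AddCommGroup W] [Module k W] [AddCommGroup U] [Module k U]
    (p : V →ₗ[k] W) (g : V →ₗ[k] U)
    (hp : Function.Surjective p) (h : LinearMap.ker p ≤ LinearMap.ker g) :
    ∃ t : W →ₗ[k] U, ∀ x, t (p x) = g x := by
  refine ⟨(LinearMap.ker p).liftQ g h ∘ₗ (p.quotKerEquivOfSurjective hp).symm.toLinearMap,
    fun x => ?_⟩
  have : (p.quotKerEquivOfSurjective hp).symm (p x) = Submodule.Quotient.mk x :=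
    (LinearEquiv.symm_apply_eq _).2 rfl
  simp [this]

/-! ### Submodules, quotients and colimits of left modules -/

namespace LeftModules

variable {k : Type u} [Field k] {C : Type u} [SmallCategory C] [Preadditive C] [Linear k C]

/-- The action of the morphisms of `C` on the elements of a left `C`-module, as a bilinear map. -/
noncomputable def act (M : LeftModules k C) {c d : C} :
    (c ⟶ d) →ₗ[k] M.obj.obj c →ₗ[k] M.obj.obj d where
  toFun f := (M.obj.map f).hom
  map_add' f g := by
    have := M.property.1
    rw [M.obj.map_add, ModuleCat.hom_add]
  map_smul' a f := by
    have := M.property.2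
    rw [M.obj.map_smul, ModuleCat.hom_smul, RingHom.id_apply]

/-- The component at `d` of a morphism of left modules. -/
def app {M N : LeftModules k C} (φ : M ⟶ N) (d : C) : M.obj.obj d →ₗ[k] N.obj.obj d :=
  (φ.hom.app d).hom

theorem act_id (M : LeftModules k C) (c : C) (x : M.obj.obj c) : M.act (𝟙 c) x = x := by
  change (M.obj.map (𝟙 c)).hom x = x
  simp

theorem act_comp (M : LeftModules k C) {c d e : C} (f : c ⟶ d) (g : d ⟶ e) (x : M.obj.obj c) :
    M.act (f ≫ g) x = M.act g (M.act f x) := by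
  change (M.obj.map (f ≫ g)).hom x = _
  rw [M.obj.map_comp]; rfl

theorem app_act {M N : LeftModules k C} (φ : M ⟶ N) {c d : C} (f : c ⟶ d) (x : M.obj.obj c) :
    app φ d (M.act f x) = N.act f (app φ c x) :=
  ConcreteCategory.congr_hom (φ.hom.naturality f) x

theorem app_comp {M N P : LeftModules k C} (φ : M ⟶ N) (ψ : N ⟶ P) (d : C) (x : M.obj.obj d) :
    app (φ ≫ ψ) d x = app ψ d (app φ d x) := rfl

theorem app_id (M : LeftModules k C) (d : C) (x : M.obj.obj d) : app (𝟙 M) d x = x := rfl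

theorem app_zero (M N : LeftModules k C) (d : C) (x : M.obj.obj d) :
    app (0 : M ⟶ N) d x = 0 := rfl

theorem hom_ext_app {M N : LeftModules k C} {φ ψ : M ⟶ N}
    (h : ∀ d x, app φ d x = app ψ d x) : φ = ψ := by
  apply ObjectProperty.hom_ext
  ext d x
  exact h d x

/-- A morphism of left modules from its components. -/
def mkHom {M N : LeftModules k C} (f : ∀ d, M.obj.obj d →ₗ[k] N.obj.obj d)
    (hf : ∀ {c d : C} (g : c ⟶ d) (x : M.obj.obj c), f d (M.act g x) = N.act g (f c x)) : M ⟶ N :=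
  ObjectProperty.homMk
    { app := fun d => ModuleCat.ofHom (f d)
      naturality := fun c d g => by
        ext x
        exact hf g x }

theorem app_hom_inv {M N : LeftModules k C} (e : M ≅ N) (d : C) (x : N.obj.obj d) :
    app e.hom d (app e.inv d x) = x := by
  rw [← app_comp, e.inv_hom_id, app_id]

theorem app_inv_hom {M N : LeftModules k C} (e : M ≅ N) (d : C) (x : M.obj.obj d) :
    app e.inv d (app e.hom d x) = x := by
  rw [← app_comp, e.hom_inv_id, app_id]

theorem nonempty_iso_of_bijective {M N : LeftModules k C} (φ : M ⟶ N)
    (h : ∀ d, Function.Bijective (app φ d)) : Nonempty (M ≅ N) := by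
  refine ⟨⟨φ, mkHom (fun d => (LinearEquiv.ofBijective _ (h d)).symm) ?_, ?_, ?_⟩⟩
  · intro c d g x
    obtain ⟨y, rfl⟩ := (h c).2 x
    rw [← app_act]
    exact ((LinearEquiv.ofBijective _ (h d)).symm_apply_apply _).trans
      (congrArg _ ((LinearEquiv.ofBijective _ (h c)).symm_apply_apply y).symm)
  · exact hom_ext_app fun d x => (LinearEquiv.ofBijective _ (h d)).symm_apply_apply x
  · exact hom_ext_app fun d x => (LinearEquiv.ofBijective _ (h d)).apply_symm_apply x

/-- A submodule of a left `C`-module: a family of subspaces stable under the action of `C`. -/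
structure Sub (M : LeftModules k C) where
  carrier : ∀ d : C, Submodule k (M.obj.obj d)
  act_mem : ∀ {c d : C} (f : c ⟶ d) {x : M.obj.obj c}, x ∈ carrier c → M.act f x ∈ carrier d

namespace Sub

variable {M : LeftModules k C}

/-- A submodule, regarded as a left module. -/
noncomputable def toModule (S : Sub M) : LeftModules k C where
  obj :=
    { obj := fun d => ModuleCat.of k (S.carrier d)
      map := fun {c d} f => ModuleCat.ofHom
        ((M.act f).restrict (p := S.carrier c) (q := S.carrier d) fun _ hx => S.act_mem f hx)
      map_id := fun c => by
        refine ModuleCat.hom_ext (LinearMap.ext fun x => ?_)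
        exact Subtype.ext (M.act_id c x.1)
      map_comp := fun f g => by
        refine ModuleCat.hom_ext (LinearMap.ext fun x => ?_)
        exact Subtype.ext (M.act_comp f g x.1) }
  property := by
    refine ⟨⟨fun {c d f g} => ?_⟩, ⟨fun {c d} f a => ?_⟩⟩
    · ext x
      change M.act (f + g) x.1 = M.act f x.1 + M.act g x.1
      rw [map_add, LinearMap.add_apply]
    · ext x
      change M.act (a • f) x.1 = a • M.act f x.1
      rw [map_smul, LinearMap.smul_apply]

/-- The inclusion of one submodule into a larger one. -/
noncomputable def inclusion {S T : Sub M} (h : ∀ d, S.carrier d ≤ T.carrier d) :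
    S.toModule ⟶ T.toModule :=
  mkHom (fun d => Submodule.inclusion (h d)) fun _ _ => rfl

/-- The inclusion of a submodule into the module. -/
noncomputable def subtype (S : Sub M) : S.toModule ⟶ M :=
  mkHom (fun d => (S.carrier d).subtype) fun _ _ => rfl

/-- The quotient of a left module by a submodule. -/
noncomputable def quotient (S : Sub M) : LeftModules k C where
  obj :=
    { obj := fun d => ModuleCat.of k (M.obj.obj d ⧸ S.carrier d)
      map := fun {c d} f => ModuleCat.ofHom
        (Submodule.mapQ (S.carrier c) (S.carrier d) (M.act f) fun _ hx => S.act_mem f hx)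
      map_id := fun c => by
        apply ModuleCat.hom_ext
        refine Submodule.linearMap_qext _ (LinearMap.ext fun x => ?_)
        exact congrArg (Submodule.Quotient.mk (p := S.carrier c)) (M.act_id c x)
      map_comp := fun {c d e} f g => by
        apply ModuleCat.hom_ext
        refine Submodule.linearMap_qext _ (LinearMap.ext fun x => ?_)
        exact congrArg (Submodule.Quotient.mk (p := S.carrier e)) (M.act_comp f g x) }
  property := by
    refine ⟨⟨fun {c d f g} => ?_⟩, ⟨fun {c d} f a => ?_⟩⟩
    · apply ModuleCat.hom_ext
      refine Submodule.linearMap_qext _ (LinearMap.ext fun x => ?_)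
      refine congrArg (Submodule.Quotient.mk (p := S.carrier d))
        (?_ : M.act (f + g) x = M.act f x + M.act g x)
      rw [map_add, LinearMap.add_apply]
    · apply ModuleCat.hom_ext
      refine Submodule.linearMap_qext _ (LinearMap.ext fun x => ?_)
      refine congrArg (Submodule.Quotient.mk (p := S.carrier d))
        (?_ : M.act (a • f) x = a • M.act f x)
      rw [map_smul, LinearMap.smul_apply]

/-- The projection of a module onto its quotient by a submodule. -/
noncomputable def mkQ (S : Sub M) : M ⟶ S.quotient :=
  mkHom (fun d => (S.carrier d).mkQ) fun _ _ => rfl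

theorem app_mkQ_eq_zero_iff (S : Sub M) {d : C} {x : M.obj.obj d} :
    app S.mkQ d x = 0 ↔ x ∈ S.carrier d :=
  Submodule.Quotient.mk_eq_zero _

theorem app_mkQ_surjective (S : Sub M) (d : C) : Function.Surjective (app S.mkQ d) :=
  Submodule.mkQ_surjective _

/-- The kernel of a morphism of left modules. -/
def ker {N : LeftModules k C} (φ : M ⟶ N) : Sub M where
  carrier d := LinearMap.ker (app φ d)
  act_mem f x hx := by
    rw [LinearMap.mem_ker] at hx ⊢
    rw [app_act, hx, map_zero]

/-- The image of a morphism of left modules. -/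
def range {N : LeftModules k C} (φ : M ⟶ N) : Sub N where
  carrier d := LinearMap.range (app φ d)
  act_mem := by
    rintro c d f _ ⟨x, rfl⟩
    exact ⟨M.act f x, app_act φ f x⟩

end Sub

theorem app_injective_of_mono {M N : LeftModules k C} (φ : M ⟶ N) [Mono φ] (d : C) :
    Function.Injective (app φ d) := by
  rw [injective_iff_map_eq_zero]
  intro x hx
  -- The inclusion of the kernel composes to zero with `φ`, hence is itself zero.
  have h0 : (Sub.ker φ).subtype = 0 := by
    rw [← cancel_mono φ, zero_comp]
    exact hom_ext_app fun d y => Subtype.property (p := fun z => z ∈ (Sub.ker φ).carrier d) y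
  exact congrArg (fun ψ => app ψ d (⟨x, hx⟩ : (Sub.ker φ).carrier d)) h0

theorem mono_of_app_injective {M N : LeftModules k C} (φ : M ⟶ N)
    (h : ∀ d, Function.Injective (app φ d)) : Mono φ :=
  ⟨fun _ _ hfg => hom_ext_app fun d x => h d (congrArg (fun ψ => app ψ d x) hfg)⟩

theorem app_surjective_of_epi {M N : LeftModules k C} (φ : M ⟶ N) [Epi φ] (d : C) :
    Function.Surjective (app φ d) := by
  intro y
  have h0 : (Sub.range φ).mkQ = 0 := by
    rw [← cancel_epi φ]
    refine hom_ext_app fun d x => ?_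
    exact (Sub.range φ).app_mkQ_eq_zero_iff.2 ⟨x, rfl⟩
  exact (Sub.range φ).app_mkQ_eq_zero_iff.1 (congrArg (fun ψ => app ψ d y) h0)

/-- A cokernel of `i` is exact at every object. -/
theorem mem_range_of_isColimit_cokernelCofork {M N Q : LeftModules k C} {i : M ⟶ N} {p : N ⟶ Q}
    {w : i ≫ p = 0} (h : IsColimit (CokernelCofork.ofπ p w)) {d : C} {x : N.obj.obj d}
    (hx : app p d x = 0) : ∃ z, app i d z = x := by
  have h0 : i ≫ (Sub.range i).mkQ = 0 :=
    hom_ext_app fun d x => (Sub.range i).app_mkQ_eq_zero_iff.2 ⟨x, rfl⟩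
  obtain ⟨t, ht⟩ := CokernelCofork.IsColimit.desc' h _ h0
  apply (Sub.range i).app_mkQ_eq_zero_iff.1
  rw [← ht, app_comp]
  exact (congrArg _ hx).trans (map_zero _)

theorem app_surjective_of_isColimit_cokernelCofork {M N Q : LeftModules k C} {i : M ⟶ N}
    {p : N ⟶ Q} {w : i ≫ p = 0} (h : IsColimit (CokernelCofork.ofπ p w)) (d : C) :
    Function.Surjective (app p d) := by
  have : Epi p := Cofork.IsColimit.epi h
  exact app_surjective_of_epi p d

/-- A complex `M ⟶ N ⟶ Q` that is right exact at every object exhibits `Q` as a cokernel. -/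
theorem nonempty_isColimit_cokernelCofork {M N Q : LeftModules k C} {i : M ⟶ N} {p : N ⟶ Q}
    (w : i ≫ p = 0) (hp : ∀ d, Function.Surjective (app p d))
    (hi : ∀ d x, app p d x = 0 → ∃ z, app i d z = x) :
    Nonempty (IsColimit (CokernelCofork.ofπ p w)) := by
  have hepi : Epi p := ⟨fun f g hfg => hom_ext_app fun d x => by
    obtain ⟨y, rfl⟩ := hp d x
    exact congrArg (fun ψ => app ψ d y) hfg⟩
  refine ⟨CokernelCofork.IsColimit.ofπ' p w fun {Z} g hg => ?_⟩
  have hker : ∀ d, LinearMap.ker (app p d) ≤ LinearMap.ker (app g d) := fun d x hx => by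
    obtain ⟨z, rfl⟩ := hi d x hx
    exact congrArg (fun ψ => app ψ d z) hg
  choose t ht using fun d => LinearMap.exists_comp_eq_of_ker_le (app p d) (app g d) (hp d) (hker d)
  refine ⟨mkHom t ?_, hom_ext_app ht⟩
  intro c d f x
  obtain ⟨y, rfl⟩ := hp c x
  rw [← app_act, ht, ht, app_act]

instance (J : Type u) [SmallCategory J] :
    ObjectProperty.IsClosedUnderColimitsOfShape
      (fun F : C ⥤ ModuleCat.{u} k => F.Additive ∧ F.Linear k) J := by
  refine ⟨?_⟩
  rintro X ⟨⟨P, hP⟩⟩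
  have hcolim (d : C) : IsColimit (((evaluation C (ModuleCat.{u} k)).obj d).mapCocone P.cocone) :=
    isColimitOfPreserves _ P.isColimit
  -- Identities between maps out of `X.obj c` can be checked on the legs of the colimit cocone.
  have hnat (j : J) {c d : C} (f : c ⟶ d) :
      (P.ι.app j).app c ≫ X.map f = (P.diag.obj j).map f ≫ (P.ι.app j).app d :=
    ((P.ι.app j).naturality f).symm
  refine ⟨⟨fun {c d f g} => (hcolim c).hom_ext fun j => ?_⟩,
    ⟨fun {c d} f a => (hcolim c).hom_ext fun j => ?_⟩⟩
  · have := (hP j).1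
    change (P.ι.app j).app c ≫ _ = (P.ι.app j).app c ≫ _
    rw [Preadditive.comp_add, hnat, hnat, hnat, Functor.map_add, Preadditive.add_comp]
  · have := (hP j).1
    have := (hP j).2
    change (P.ι.app j).app c ≫ _ = (P.ι.app j).app c ≫ _
    rw [Linear.comp_smul, hnat, hnat, Functor.map_smul, Linear.smul_comp]

/-- The elements of the colimit of a chain of left modules come from the chain. -/
theorem exists_app_eq_of_isColimit {J : Type*} [LinearOrder J] [Nonempty J] [Small.{u} J]
    {F : J ⥤ LeftModules k C} {s : Cocone F} (hs : IsColimit s) {d : C} (x : s.pt.obj.obj d) :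
    ∃ (j : J) (y : (F.obj j).obj.obj d), app (s.ι.app j) d y = x := by
  have : Nonempty (Shrink.{u} J) := (equivShrink J).symm.nonempty
  -- The chain is reindexed by a type in the universe of the modules, so that evaluation and the
  -- forgetful functor preserve its colimit.
  obtain ⟨j, y, hy⟩ := Concrete.isColimit_exists_rep _
    (isColimitOfPreserves (ObjectProperty.ι _ ⋙ (evaluation C (ModuleCat.{u} k)).obj d)
      (hs.whiskerEquivalence (orderIsoShrink.{u} J).symm.equivalence)) x
  exact ⟨_, y, hy⟩

/-- An element that vanishes in the colimit of a chain of left modules vanishes at some stage. -/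
theorem exists_app_map_eq_zero_of_isColimit {J : Type*} [LinearOrder J] [Nonempty J] [Small.{u} J]
    {F : J ⥤ LeftModules k C} {s : Cocone F} (hs : IsColimit s) {d : C} {i : J}
    (x : (F.obj i).obj.obj d) (hx : app (s.ι.app i) d x = 0) :
    ∃ (j : J) (f : i ⟶ j), app (F.map f) d x = 0 := by
  have : Nonempty (Shrink.{u} J) := (equivShrink J).symm.nonempty
  let e := (orderIsoShrink.{u} J).symm
  obtain ⟨i, rfl⟩ := e.surjective i
  have h1 := isColimitOfPreserves
    (ObjectProperty.ι _ ⋙ (evaluation C (ModuleCat.{u} k)).obj d)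
    (hs.whiskerEquivalence e.equivalence)
  obtain ⟨j, f, g, h⟩ := Concrete.isColimit_exists_of_rep_eq.{u} _ h1 x
    (0 : (F.obj (e i)).obj.obj d) (hx.trans (map_zero (app (s.ι.app (e i)) d)).symm)
  exact ⟨_, _, h.trans (map_zero (app (F.map (e.equivalence.functor.map g)) d))⟩

/-! ### Direct systems of left modules -/

theorem app_map_map {I : Type*} [Preorder I] (F : I ⥤ LeftModules k C)
    {a b c : I} (f : a ⟶ b) (g : b ⟶ c) (h : a ⟶ c) (d : C) (x : (F.obj a).obj.obj d) :
    app (F.map g) d (app (F.map f) d x) = app (F.map h) d x := by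
  rw [← app_comp, ← F.map_comp, Subsingleton.elim (f ≫ g) h]

variable {σ : Ordinal.{u}} {F : Set.Iic σ ⥤ LeftModules k C}

/-- The elements of a limit stage of a continuous chain come from earlier stages. -/
theorem exists_app_map_eq_of_isSuccLimit [F.IsWellOrderContinuous]
    {β : Ordinal.{u}} (hβ : β ≤ σ) (h : Order.IsSuccLimit β) {d : C}
    (x : (F.obj ⟨β, hβ⟩).obj.obj d) :
    ∃ (α : Ordinal.{u}) (hα : α < β) (y : (F.obj ⟨α, hα.le.trans hβ⟩).obj.obj d),
      app (F.map (homOfLE hα.le)) d y = x := by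
  have hlim := Set.isSuccLimit_mk_Iic hβ h
  have : Nonempty (Set.Iio (⟨β, hβ⟩ : Set.Iic σ)) := by
    have h0 : 0 < β := pos_iff_ne_zero.2 h.ne_bot
    exact ⟨⟨⟨0, h0.le.trans hβ⟩, h0⟩⟩
  obtain ⟨j, y, hy⟩ := exists_app_eq_of_isColimit
    (F.isColimitOfIsWellOrderContinuous _ hlim) x
  exact ⟨j.1.1, j.2, y, hy⟩

/-- In a continuous chain, an element that vanishes at a limit stage vanishes earlier. -/
theorem exists_app_map_eq_zero_of_isSuccLimit [F.IsWellOrderContinuous]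
    {α β : Ordinal.{u}} (hβ : β ≤ σ) (h : Order.IsSuccLimit β) (hα : α < β) {d : C}
    (x : (F.obj ⟨α, hα.le.trans hβ⟩).obj.obj d)
    (hx : app (F.map (homOfLE hα.le : _ ⟶ (⟨β, hβ⟩ : Set.Iic σ))) d x = 0) :
    ∃ (γ : Ordinal.{u}) (hαγ : α ≤ γ) (hγ : γ < β),
      app (F.map (homOfLE hαγ : _ ⟶ (⟨γ, hγ.le.trans hβ⟩ : Set.Iic σ))) d x = 0 := by
  have hlim := Set.isSuccLimit_mk_Iic hβ h
  have : Nonempty (Set.Iio (⟨β, hβ⟩ : Set.Iic σ)) := ⟨⟨⟨α, hα.le.trans hβ⟩, hα⟩⟩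
  obtain ⟨j, f, hj⟩ := exists_app_map_eq_zero_of_isColimit
    (i := (⟨⟨α, hα.le.trans hβ⟩, hα⟩ : Set.Iio (⟨β, hβ⟩ : Set.Iic σ)))
    (F.isColimitOfIsWellOrderContinuous _ hlim) x hx
  exact ⟨j.1.1, leOfHom f, j.2, hj⟩

/-- In a continuous chain whose steps are monomorphisms all transition maps are injective. -/
theorem app_map_injective [F.IsWellOrderContinuous]
    (hF : ∀ (α : Ordinal.{u}) (hα : α < σ), Mono (F.map (homOfLE (Order.le_succ α) :
      (⟨α, hα.le⟩ : Set.Iic σ) ⟶ ⟨Order.succ α, Order.succ_le_of_lt hα⟩)))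
    {α β : Ordinal.{u}} (hα : α ≤ β) (hβ : β ≤ σ) (d : C) :
    Function.Injective (app
      (F.map (homOfLE hα : (⟨α, hα.trans hβ⟩ : Set.Iic σ) ⟶ ⟨β, hβ⟩)) d) := by
  rw [injective_iff_map_eq_zero]
  induction β using WellFoundedLT.induction with
  | ind β ih =>
  intro x hx
  -- `β = α` apart, `β` is a successor, where the step is injective, or a limit, where an element
  -- that vanishes already vanishes at a stage before `β`.
  obtain rfl | hlt := hα.eq_or_lt
  · rw [← hx, ← app_id _ d x]
    exact congrArg (fun φ => app φ d x) (F.map_id _).symm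
  obtain rfl | ⟨γ, rfl⟩ | hlim := Ordinal.zero_or_succ_or_isSuccLimit β
  · exact absurd hlt not_lt_zero
  · have hγ : γ < σ := Order.succ_le_iff.1 hβ
    have hαγ : α ≤ γ := Order.lt_succ_iff.1 hlt
    refine ih γ (Order.lt_succ γ) hαγ hγ.le x ?_
    have := hF γ hγ
    apply app_injective_of_mono (F.map (homOfLE (Order.le_succ γ) :
      (⟨γ, hγ.le⟩ : Set.Iic σ) ⟶ ⟨Order.succ γ, Order.succ_le_of_lt hγ⟩)) d
    rw [map_zero, app_map_map F _ _ (homOfLE hα), hx]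
  · obtain ⟨γ, hαγ, hγ, h⟩ :=
      exists_app_map_eq_zero_of_isSuccLimit hβ hlim hlt x hx
    exact ih γ hγ hαγ _ x h

variable {N : LeftModules k C}

/-- An increasing chain of submodules, as a direct system of left modules. -/
noncomputable def Sub.chain (σ : Ordinal.{u}) (S : Ordinal.{u} → Sub N)
    (hS : ∀ d, Monotone fun α => (S α).carrier d) : Set.Iic σ ⥤ LeftModules k C where
  obj a := (S a.1).toModule
  map f := Sub.inclusion fun d => hS d (leOfHom f)
  map_id _ := hom_ext_app fun _ _ => rfl
  map_comp _ _ := hom_ext_app fun _ _ => rfl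

theorem Sub.chain_isWellOrderContinuous {σ : Ordinal.{u}} {S : Ordinal.{u} → Sub N}
    (hS : ∀ d, Monotone fun α => (S α).carrier d)
    (hlim : ∀ β, Order.IsSuccLimit β → ∀ d, ∀ x ∈ (S β).carrier d, ∃ α < β, x ∈ (S α).carrier d) :
    (Sub.chain σ S hS).IsWellOrderContinuous := by
  refine ⟨fun m hm => ?_⟩
  have hex : ∀ d, ∀ x ∈ (S m.1).carrier d, ∃ j : Set.Iio m, x ∈ (S j.1.1).carrier d := by
    intro d x hx
    obtain ⟨α, hα, hxα⟩ := hlim m.1 (Set.isSuccLimit_coe_Iic hm) d x hx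
    exact ⟨⟨⟨α, hα.le.trans m.2⟩, hα⟩, hxα⟩
  have hdesc : ∀ s : Cocone ((Set.principalSegIio m).monotone.functor ⋙ Sub.chain σ S hS),
      ∃ t : (S m.1).toModule ⟶ s.pt,
        ∀ j, ((Set.principalSegIio m).cocone (Sub.chain σ S hS)).ι.app j ≫ t = s.ι.app j := by
    intro s
    let f : ∀ (j : Set.Iio m) (d : C), (S j.1.1).carrier d →ₗ[k] s.pt.obj.obj d :=
      fun j d => app (s.ι.app j) d
    choose g hg using fun d => Submodule.exists_linearMap_of_chain (P := s.pt.obj.obj d)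
      (T := fun j : Set.Iio m => (S j.1.1).carrier d) (fun i j hij => hS d hij)
      (fun j => hS d j.2.le) (hex d) (fun j => f j d) (fun i j hij x =>
        congrArg (fun φ => app φ d x) (s.w (homOfLE hij)))
    refine ⟨mkHom g fun {c d} f x => ?_, fun j => hom_ext_app fun d x => hg d j x⟩
    obtain ⟨x, hx⟩ := (x : (S m.1).carrier c)
    obtain ⟨j, hj⟩ := hex c x hx
    have h1 := hg d j ⟨N.act f x, (S j.1.1).act_mem f hj⟩
    have h2 := hg c j ⟨x, hj⟩
    refine h1.trans (Eq.trans ?_ (congrArg (s.pt.act f) h2.symm))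
    exact app_act (s.ι.app j) f (⟨x, hj⟩ : (S j.1.1).carrier c)
  choose t ht using hdesc
  refine ⟨{ desc := t, fac := ht, uniq := fun s t' ht' => hom_ext_app fun d x => ?_ }⟩
  obtain ⟨x, hx⟩ := (x : (S m.1).carrier d)
  obtain ⟨j, hj⟩ := hex d x hx
  exact congrArg (fun φ => app φ d (⟨x, hj⟩ : (S j.1.1).carrier d)) ((ht' j).trans (ht s j).symm)

end LeftModules

/-! ### The direct and inverse subcategories -/

theorem WideLinearSubcategory.exists_eq_smul_id {k : Type u} [Field k] {C : Type u}
    [SmallCategory C] [Preadditive C] [Linear k C] (H : WideLinearSubcategory k C) {c : C}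
    (e : Nonempty (H.hom c c ≃ₗ[k] k)) :
    ∀ f ∈ H.hom c c, ∃ a : k, f = a • 𝟙 c := by
  obtain ⟨e⟩ := e
  have h1 : 𝟙 c ≠ 0 := fun h => by
    have h0 : ∀ x : H.hom c c, x = 0 := fun x => Subtype.ext (by
      rw [← Category.comp_id x.1, h, comp_zero]; rfl)
    have := congrArg e (h0 (e.symm 1))
    rw [e.apply_symm_apply, map_zero] at this
    exact one_ne_zero this
  intro f hf
  set i : H.hom c c := ⟨𝟙 c, H.id_mem c⟩
  have hi : e i ≠ 0 := fun h => h1 (congrArg Subtype.val (e.map_eq_zero_iff.1 h))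
  refine ⟨e ⟨f, hf⟩ / e i, ?_⟩
  have : (⟨f, hf⟩ : H.hom c c) = (e ⟨f, hf⟩ / e i) • i := by
    apply e.injective
    rw [map_smul, smul_eq_mul, div_mul_cancel₀ _ hi]
  exact congrArg Subtype.val this

namespace LinearReedyStructure

variable {k : Type u} [Field k] {C : Type u} [SmallCategory C] [Preadditive C] [Linear k C]
  (R : LinearReedyStructure k C)

theorem exists_eq_smul_id_of_mem_plus {c : C} {f : c ⟶ c} (hf : f ∈ R.plus.hom c c) :
    ∃ a : k, f = a • 𝟙 c :=
  (R.plus.exists_eq_smul_id (R.plus_isDirect.nonempty_end_equiv c)) f hf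

theorem exists_eq_smul_id_of_mem_minus {c : C} {f : c ⟶ c} (hf : f ∈ R.minus.hom c c) :
    ∃ a : k, f = a • 𝟙 c :=
  (R.minus.exists_eq_smul_id (R.minus_isInverse.nonempty_end_equiv c)) f hf

/-- Every morphism lies in `C⁺(c,d) + I_{<deg c}(c,d)`: in its factorization, the part through
`c` itself lies in `C⁺`, because `C⁻(c,c)` consists of scalars. -/
theorem exists_plus_sub_mem_idealLT {c d : C} (f : c ⟶ d) :
    ∃ h ∈ R.plus.hom c d, f - h ∈ R.idealLT (R.deg c) c d := by
  have hf := R.mem_span_factorization f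
  induction hf using Submodule.span_induction with
  | zero => exact ⟨0, zero_mem _, by simp⟩
  | add x y _ _ hx hy =>
    obtain ⟨h, hh, hx⟩ := hx
    obtain ⟨h', hh', hy⟩ := hy
    refine ⟨h + h', add_mem hh hh', ?_⟩
    rw [add_sub_add_comm]
    exact add_mem hx hy
  | smul a x _ hx =>
    obtain ⟨h, hh, hx⟩ := hx
    refine ⟨a • h, Submodule.smul_mem _ a hh, ?_⟩
    rw [← smul_sub]
    exact Submodule.smul_mem _ a hx
  | mem x hx =>
    obtain ⟨e, g, hg, h, hh, rfl⟩ := hx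
    by_cases hce : c = e
    · subst hce
      obtain ⟨a, rfl⟩ := R.exists_eq_smul_id_of_mem_minus hg
      refine ⟨a • h, Submodule.smul_mem _ a hh, ?_⟩
      simp
    · by_cases hg0 : g = 0
      · exact ⟨0, zero_mem _, by simp [hg0]⟩
      · refine ⟨0, zero_mem _, ?_⟩
        rw [sub_zero, idealLT_eq_span]
        exact Submodule.subset_span
          ⟨e, R.minus_isInverse.deg_lt_deg g hg hg0 hce, g, hg, h, hh, rfl⟩

/-- The sum `C⁺(c,d) + I_{<deg c}(c,d)` is direct, because composition is injective on
`⨁ₑ C⁺(e,d) ⊗ C⁻(c,e)`. -/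
theorem eq_zero_of_mem_plus_of_mem_idealLT {c d : C} {h : c ⟶ d} (hh : h ∈ R.plus.hom c d)
    (hI : h ∈ R.idealLT (R.deg c) c d) : h = 0 := by
  classical
  -- `π` is the component at `c` of the factorization; it is faithful on `C⁺(c,d)` and kills
  -- `I_{<deg c}(c,d)`.
  let E := LinearEquiv.ofBijective _ (R.bijective_factorization c d)
  let π : (c ⟶ d) →ₗ[k] (R.plus.hom c d) ⊗[k] (R.minus.hom c c) := DirectSum.component k C
    (fun e => (R.plus.hom e d) ⊗[k] (R.minus.hom c e)) c ∘ₗ E.symm.toLinearMap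
  have hE : ∀ (e : C) (g : R.minus.hom c e) (h : R.plus.hom e d),
      E.symm (g.1 ≫ h.1) = DirectSum.lof k C
        (fun e => (R.plus.hom e d) ⊗[k] (R.minus.hom c e)) e (h ⊗ₜ g) := fun e g h => by
    rw [LinearEquiv.symm_apply_eq]
    exact (DirectSum.toModule_lof k (φ := fun e => factorizationMap R.plus R.minus c d e)
      e (h ⊗ₜ g)).symm
  have h1 : π h = (⟨h, hh⟩ : R.plus.hom c d) ⊗ₜ (⟨𝟙 c, R.minus.id_mem c⟩ : R.minus.hom c c) := by
    have := hE c ⟨𝟙 c, R.minus.id_mem c⟩ ⟨h, hh⟩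
    rw [Category.id_comp] at this
    change DirectSum.component k C _ c (E.symm h) = _
    rw [this, DirectSum.component.lof_self]
  have h2 : R.idealLT (R.deg c) c d ≤ LinearMap.ker π := by
    rw [idealLT_eq_span, Submodule.span_le]
    rintro _ ⟨e, he, g, hg, h, hh, rfl⟩
    have hec : e ≠ c := by rintro rfl; exact lt_irrefl _ he
    change DirectSum.component k C _ c (E.symm (g ≫ h)) = 0
    rw [hE e ⟨g, hg⟩ ⟨h, hh⟩, DirectSum.component.of, dif_neg hec]
  have h3 := h1.symm.trans (h2 hI)
  have h4 := congrArg (factorizationMap R.plus R.minus c d c) h3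
  rw [map_zero] at h4
  exact (Category.id_comp h).symm.trans h4

/-! ### Bases over the direct subcategory -/

/-- The span of `x` under the action of `C⁺`. -/
def plusSpan (M : LeftModules k C) {L : Type*} (c : L → C) (x : ∀ l, M.obj.obj (c l)) (d : C) :
    Submodule k (M.obj.obj d) :=
  Submodule.span k {y | ∃ l, ∃ h ∈ R.plus.hom (c l) d, M.act h (x l) = y}

open Classical in
/-- The map `⨁ₗ C⁺(c l, d) → M(d)` sending `h` in the summand of index `l` to `h · x l`. -/
noncomputable def plusMap (M : LeftModules k C) {L : Type*} (c : L → C)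
    (x : ∀ l, M.obj.obj (c l)) (d : C) : (Π₀ l, R.plus.hom (c l) d) →ₗ[k] M.obj.obj d :=
  DFinsupp.lsum k fun l => M.act.flip (x l) ∘ₗ (R.plus.hom (c l) d).subtype

/-- The family `x` is a basis of the restriction of `M` to the direct subcategory `C⁺`. -/
def IsPlusBasis (M : LeftModules k C) {L : Type*} (c : L → C) (x : ∀ l, M.obj.obj (c l)) : Prop :=
  ∀ d, Function.Bijective (R.plusMap M c x d)

section

variable {R} {M : LeftModules k C} {L : Type*} {c : L → C} {x : ∀ l, M.obj.obj (c l)}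

theorem plusMap_apply [DecidableEq L] {d : C} (v : Π₀ l, R.plus.hom (c l) d)
    [∀ l (h : R.plus.hom (c l) d), Decidable (h ≠ 0)] :
    R.plusMap M c x d v = ∑ l ∈ v.support, M.act (v l).1 (x l) := by
  rw [plusMap, DFinsupp.lsum_apply_apply]
  convert DFinsupp.sumAddHom_apply (fun l => (M.act.flip (x l) ∘ₗ
    (R.plus.hom (c l) d).subtype).toAddMonoidHom) v
  rfl

open Classical in
theorem plusMap_single {d : C} (l : L) (h : R.plus.hom (c l) d) :
    R.plusMap M c x d (DFinsupp.single l h) = M.act h.1 (x l) := by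
  rw [plusMap, DFinsupp.lsum_single]
  rfl

theorem act_mem_plusSpan {d : C} (l : L) {h : c l ⟶ d} (hh : h ∈ R.plus.hom (c l) d) :
    M.act h (x l) ∈ R.plusSpan M c x d :=
  Submodule.subset_span ⟨l, h, hh, rfl⟩

theorem mem_plusSpan_self (l : L) : x l ∈ R.plusSpan M c x (c l) := by
  have := act_mem_plusSpan (R := R) (M := M) (x := x) l (R.plus.id_mem (c l))
  rwa [M.act_id] at this

theorem act_mem_plusSpan_of_mem {d d' : C} {h : d ⟶ d'} (hh : h ∈ R.plus.hom d d')
    {y : M.obj.obj d} (hy : y ∈ R.plusSpan M c x d) : M.act h y ∈ R.plusSpan M c x d' := by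
  induction hy using Submodule.span_induction with
  | zero => rw [map_zero]; exact zero_mem _
  | add y z _ _ hy hz => rw [map_add]; exact add_mem hy hz
  | smul a y _ hy => rw [map_smul]; exact Submodule.smul_mem _ a hy
  | mem y hy =>
    obtain ⟨l, g, hg, rfl⟩ := hy
    rw [← M.act_comp]
    exact act_mem_plusSpan l (R.plus.comp_mem g h hg hh)

theorem range_plusMap (d : C) : LinearMap.range (R.plusMap M c x d) = R.plusSpan M c x d := by
  classical
  apply le_antisymm
  · rintro _ ⟨v, rfl⟩
    rw [plusMap_apply]
    exact Submodule.sum_mem _ fun l _ => act_mem_plusSpan l (v l).2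
  · rw [plusSpan, Submodule.span_le]
    rintro _ ⟨l, h, hh, rfl⟩
    exact ⟨DFinsupp.single l ⟨h, hh⟩, plusMap_single l _⟩

theorem plusMap_surjective_iff {d : C} :
    Function.Surjective (R.plusMap M c x d) ↔ R.plusSpan M c x d = ⊤ := by
  rw [← LinearMap.range_eq_top, range_plusMap]

theorem IsPlusBasis.plusSpan_eq_top (hx : R.IsPlusBasis M c x) (d : C) :
    R.plusSpan M c x d = ⊤ :=
  plusMap_surjective_iff.1 (hx d).2

/-- A family is independent over `C⁺` as soon as its index set is linearly ordered and no nonzero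
multiple of an element lies in a subspace containing all multiples of the earlier ones: consider
the last nonzero coefficient of a relation. -/
theorem plusMap_injective_of_linearOrder [LinearOrder L] {d : C}
    (S : L → Submodule k (M.obj.obj d))
    (hS : ∀ i j, i < j → ∀ h ∈ R.plus.hom (c i) d, M.act h (x i) ∈ S j)
    (h0 : ∀ j, ∀ h ∈ R.plus.hom (c j) d, M.act h (x j) ∈ S j → h = 0) :
    Function.Injective (R.plusMap M c x d) := by
  classical
  rw [injective_iff_map_eq_zero]
  intro v hv
  by_contra hne
  have hs : v.support.Nonempty := by
    rwa [Finset.nonempty_iff_ne_empty, Ne, DFinsupp.support_eq_empty]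
  let j := v.support.max' hs
  have hjs : j ∈ v.support := Finset.max'_mem _ _
  rw [plusMap_apply, ← Finset.add_sum_erase _ _ hjs] at hv
  refine (DFinsupp.mem_support_iff.1 hjs) (Subtype.ext (h0 j _ (v j).2 ?_))
  rw [eq_neg_of_add_eq_zero_left hv]
  refine neg_mem (Submodule.sum_mem _ fun i hi => ?_)
  exact hS i j (Finset.lt_max'_of_mem_erase_max' _ hs hi) _ (v i).2

/-- The universal property of a basis over `C⁺`. -/
theorem IsPlusBasis.exists_hom (hx : R.IsPlusBasis M c x) {b : C} (g : ∀ l, b ⟶ c l) (d : C) :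
    ∃ θ : M.obj.obj d →ₗ[k] (b ⟶ d),
      ∀ l, ∀ h ∈ R.plus.hom (c l) d, θ (M.act h (x l)) = g l ≫ h := by
  classical
  let E := LinearEquiv.ofBijective _ (hx d)
  refine ⟨(DFinsupp.lsum k fun l => Linear.leftComp k d (g l) ∘ₗ
    (R.plus.hom (c l) d).subtype) ∘ₗ E.symm.toLinearMap, fun l h hh => ?_⟩
  have : E.symm (M.act h (x l)) = DFinsupp.single l ⟨h, hh⟩ := by
    rw [LinearEquiv.symm_apply_eq]
    exact (plusMap_single l ⟨h, hh⟩).symm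
  rw [LinearMap.comp_apply, LinearEquiv.coe_coe, this, DFinsupp.lsum_single]
  rfl

end

/-! ### Lifting functionals on the top -/

/-- The radical of the restriction of `M` to `C⁺`: the span of all `h · y` with `h` in `C⁺` not an
endomorphism. -/
def plusRad (M : LeftModules k C) (c : C) : Submodule k (M.obj.obj c) :=
  Submodule.span k {z | ∃ e, e ≠ c ∧ ∃ h ∈ R.plus.hom e c, ∃ y, M.act h y = z}

theorem act_mem_plusRad (M : LeftModules k C) {e c : C} (hec : e ≠ c) {h : e ⟶ c}
    (hh : h ∈ R.plus.hom e c) (y : M.obj.obj e) : M.act h y ∈ R.plusRad M c :=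
  Submodule.subset_span ⟨e, hec, h, hh, y, rfl⟩

/-- Every functional on `M(c)` that vanishes on the radical is the component at `c` of a
`C⁺`-linear map `M → C⁺(c,-)`. This characterises the modules that are projective over `C⁺`, and
it visibly passes to direct summands. -/
def LiftsFunctionals (M : LeftModules k C) : Prop :=
  ∀ (c : C) (l : M.obj.obj c →ₗ[k] k), R.plusRad M c ≤ LinearMap.ker l →
    ∃ θ : ∀ d, M.obj.obj d →ₗ[k] (c ⟶ d), (∀ d y, θ d y ∈ R.plus.hom c d) ∧
      (∀ d d', ∀ h ∈ R.plus.hom d d', ∀ y, θ d' (M.act h y) = θ d y ≫ h) ∧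
      ∀ y, θ c y = l y • 𝟙 c

variable {R}

theorem IsPlusBasis.liftsFunctionals {M : LeftModules k C} {L : Type*} {c : L → C}
    {x : ∀ l, M.obj.obj (c l)} (hx : R.IsPlusBasis M c x) : R.LiftsFunctionals M := by
  intro b t ht
  -- The extension of `t` sends `x l` to `t (x l) • 𝟙` if `c l = b` and to `0` otherwise.
  have hg : ∀ l, ∃ g ∈ R.plus.hom b (c l),
      ∀ h ∈ R.plus.hom (c l) b, g ≫ h = t (M.act h (x l)) • 𝟙 b := by
    intro l
    by_cases hb : c l = b
    · subst hb
      refine ⟨t (x l) • 𝟙 _, Submodule.smul_mem _ _ (R.plus.id_mem _), fun h hh => ?_⟩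
      obtain ⟨a, rfl⟩ := R.exists_eq_smul_id_of_mem_plus hh
      simp [M.act_id, smul_smul]
    · refine ⟨0, zero_mem _, fun h hh => ?_⟩
      rw [show t (M.act h (x l)) = 0 from ht (R.act_mem_plusRad M hb hh _)]
      simp
  choose g hg hgt using hg
  choose θ hθ using hx.exists_hom g
  have hspan : ∀ d (y : M.obj.obj d), y ∈ R.plusSpan M c x d := fun d y => by
    rw [hx.plusSpan_eq_top]; trivial
  refine ⟨θ, fun d y => ?_, fun d d' h hh y => ?_, fun y => ?_⟩
  · induction hspan d y using Submodule.span_induction with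
    | zero => rw [map_zero]; exact zero_mem _
    | add y z _ _ hy hz => rw [map_add]; exact add_mem hy hz
    | smul a y _ hy => rw [map_smul]; exact Submodule.smul_mem _ a hy
    | mem y hy =>
      obtain ⟨l, h, hh, rfl⟩ := hy
      rw [hθ d l h hh]
      exact R.plus.comp_mem _ _ (hg l) hh
  · induction hspan d y using Submodule.span_induction with
    | zero => simp
    | add y z _ _ hy hz => simp [hy, hz]
    | smul a y _ hy => simp [hy]
    | mem y hy =>
      obtain ⟨l, h', hh', rfl⟩ := hy
      rw [← M.act_comp, hθ d l h' hh', hθ d' l _ (R.plus.comp_mem _ _ hh' hh), Category.assoc]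
  · induction hspan b y using Submodule.span_induction with
    | zero => simp
    | add y z _ _ hy hz => rw [map_add, map_add, hy, hz, add_smul]
    | smul a y _ hy => rw [map_smul, map_smul, hy, smul_smul, smul_eq_mul]
    | mem y hy =>
      obtain ⟨l, h, hh, rfl⟩ := hy
      rw [hθ b l h hh, hgt l h hh]

theorem LiftsFunctionals.of_retract {M N : LeftModules k C} (hM : R.LiftsFunctionals M)
    (i : N ⟶ M) (r : M ⟶ N) (hir : i ≫ r = 𝟙 N) : R.LiftsFunctionals N := by
  intro c l hl
  obtain ⟨θ, h1, h2, h3⟩ := hM c (l ∘ₗ LeftModules.app r c) (by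
    rw [plusRad, Submodule.span_le]
    rintro _ ⟨e, hec, h, hh, y, rfl⟩
    change l (LeftModules.app r c (M.act h y)) = 0
    rw [LeftModules.app_act]
    exact hl (R.act_mem_plusRad N hec hh _))
  refine ⟨fun d => θ d ∘ₗ LeftModules.app i d, fun d y => h1 d _, fun d d' h hh y => ?_,
    fun y => ?_⟩
  · rw [LinearMap.comp_apply, LeftModules.app_act, h2 d d' h hh]
    rfl
  · rw [LinearMap.comp_apply, h3, LinearMap.comp_apply, ← LeftModules.app_comp, hir,
      LeftModules.app_id]

/-- A module with the lifting property for functionals has a basis over `C⁺`: lift bases of the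
quotients by the radical. They generate by induction on the degree. In a relation between them,
a generator of maximal degree with nonzero coefficient is detected by the map to `C⁺(c,-)` lifting
the dual coordinate functional. -/
theorem LiftsFunctionals.exists_isPlusBasis {N : LeftModules k C} (hN : R.LiftsFunctionals N) :
    ∃ (J : Type u) (c : J → C) (y : ∀ j, N.obj.obj (c j)), R.IsPlusBasis N c y := by
  classical
  let b (c : C) := Module.Basis.ofVectorSpace k (N.obj.obj c ⧸ R.plusRad N c)
  let J : Type u := Σ c : C, Module.Basis.ofVectorSpaceIndex k (N.obj.obj c ⧸ R.plusRad N c)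
  have hlift : ∀ j : J, ∃ y : N.obj.obj j.1, (R.plusRad N j.1).mkQ y = b j.1 j.2 :=
    fun j => Submodule.mkQ_surjective _ _
  choose y hy using hlift
  refine ⟨J, fun j => j.1, y, fun d => ⟨?_, plusMap_surjective_iff.2 ?_⟩⟩
  · rw [injective_iff_map_eq_zero]
    intro v hv
    by_contra hne
    have hs : v.support.Nonempty := by
      rwa [Finset.nonempty_iff_ne_empty, Ne, DFinsupp.support_eq_empty]
    obtain ⟨j, hj, hmax⟩ := Finset.exists_max_image v.support (fun j => R.deg j.1) hs
    obtain ⟨θ, h1, h2, h3⟩ := hN j.1 ((b j.1).coord j.2 ∘ₗ (R.plusRad N j.1).mkQ)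
      fun z hz => by
        rw [LinearMap.mem_ker, LinearMap.comp_apply, Submodule.mkQ_apply,
          (Submodule.Quotient.mk_eq_zero _).2 hz, map_zero]
    -- Applying `θ` to the relation leaves only the term of index `j`: the others at the same object
    -- are killed by the dual functional, and the rest sit at objects of degree at most
    -- `deg j.1`, where `C⁺(j.1,-)` vanishes.
    refine DFinsupp.mem_support_iff.1 hj (Subtype.ext ?_)
    have h4 := congrArg (θ d) hv
    rw [plusMap_apply, map_sum, map_zero, Finset.sum_eq_single_of_mem (M := j.1 ⟶ d) j hj,
      h2 _ _ _ (v j).2, h3, LinearMap.comp_apply, hy, Module.Basis.coord_apply,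
      Module.Basis.repr_self] at h4
    · simpa using h4
    · rintro ⟨c', i⟩ hi hij
      rw [h2 _ _ _ (v _).2]
      suffices θ c' (y ⟨c', i⟩) = 0 by rw [this, zero_comp]
      by_cases hc : j.1 = c'
      · obtain ⟨c, i₀⟩ := j
        obtain rfl : c = c' := hc
        have hne' : i ≠ i₀ := fun h => hij (by rw [h])
        refine (h3 _).trans ?_
        change (b c).repr ((R.plusRad N c).mkQ (y ⟨c, i⟩)) i₀ • 𝟙 c = 0
        rw [show (R.plusRad N c).mkQ (y ⟨c, i⟩) = b c i from hy ⟨c, i⟩, Module.Basis.repr_self,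
          Finsupp.single_eq_of_ne (by simpa using hne'.symm), zero_smul]
      · by_contra h0
        exact (R.plus_isDirect.deg_lt_deg _ (h1 c' _) h0 hc).not_ge (hmax _ hi)
  · induction hd : R.deg d using WellFoundedLT.induction generalizing d with
    | ind α ih =>
    have hrad : R.plusRad N d ≤ R.plusSpan N (fun j : J => j.1) y d := by
      rw [plusRad, Submodule.span_le]
      rintro _ ⟨e, hed, h, hh, z, rfl⟩
      by_cases h0 : h = 0
      · rw [h0, map_zero]
        exact zero_mem _
      · refine act_mem_plusSpan_of_mem hh ?_
        rw [ih (R.deg e) (hd ▸ R.plus_isDirect.deg_lt_deg h hh h0 hed) e rfl]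
        trivial
    rw [eq_top_iff]
    intro z _
    -- `w` is the combination of generators at `d` congruent to `z` modulo the radical.
    let w := Finsupp.linearCombination k (M := N.obj.obj d) (fun i => y ⟨d, i⟩)
      ((b d).repr ((R.plusRad N d).mkQ z))
    have hw : w ∈ R.plusSpan N (fun j : J => j.1) y d := by
      refine Submodule.sum_mem _ fun i _ => Submodule.smul_mem _ _ ?_
      exact mem_plusSpan_self (R := R) (x := y) (⟨d, i⟩ : J)
    have hzw : z - w ∈ R.plusRad N d := by
      rw [← Submodule.Quotient.mk_eq_zero, ← Submodule.mkQ_apply, map_sub, sub_eq_zero]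
      conv_lhs => rw [← (b d).linearCombination_repr ((R.plusRad N d).mkQ z)]
      rw [Finsupp.apply_linearCombination]
      congr 1
      congr 1
      funext i
      exact (hy ⟨d, i⟩).symm
    rw [← sub_add_cancel z w]
    exact add_mem (hrad hzw) hw

/-! ### Filtered modules are free over the direct subcategory -/

variable (R)

/-- The class of a morphism in the standard module. -/
noncomputable def standardMk (c : C) {d : C} (f : c ⟶ d) : (R.standard c).obj.obj d :=
  Submodule.Quotient.mk (p := R.idealLT (R.deg c) c d) f

theorem act_standardMk {c d e : C} (f : c ⟶ d) (g : d ⟶ e) :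
    (R.standard c).act g (R.standardMk c f) = R.standardMk c (f ≫ g) := rfl

theorem standardMk_surjective (c d : C) : Function.Surjective (R.standardMk c (d := d)) :=
  Submodule.Quotient.mk_surjective _

theorem standardMk_eq_iff {c d : C} {f g : c ⟶ d} :
    R.standardMk c f = R.standardMk c g ↔ f - g ∈ R.idealLT (R.deg c) c d :=
  Submodule.Quotient.eq _

/-- In an extension of a module by a standard module, any lift of the generator of the standard
module generates freely over `C⁺` modulo the submodule. -/
theorem exists_generator_of_isColimit {A B Q : LeftModules k C} {i : A ⟶ B} {p : B ⟶ Q}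
    {w : i ≫ p = 0} (hQ : R.standards Q) (h : IsColimit (CokernelCofork.ofπ p w)) :
    ∃ (c : C) (x : B.obj.obj c),
      (∀ (d : C) (y : B.obj.obj d), ∃ f ∈ R.plus.hom c d, ∃ z : A.obj.obj d,
        y = B.act f x + LeftModules.app i d z) ∧
      ∀ (d : C), ∀ f ∈ R.plus.hom c d, ∀ z : A.obj.obj d,
        LeftModules.app i d z = B.act f x → f = 0 := by
  obtain ⟨c, ⟨e⟩⟩ := hQ
  obtain ⟨x, hx⟩ := LeftModules.app_surjective_of_isColimit_cokernelCofork h c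
    (LeftModules.app e.inv c (R.standardMk c (𝟙 c)))
  have hpx : ∀ {d : C} (f : c ⟶ d),
      LeftModules.app p d (B.act f x) = LeftModules.app e.inv d (R.standardMk c f) := by
    intro d f
    rw [LeftModules.app_act, hx, ← LeftModules.app_act, act_standardMk, Category.id_comp]
  refine ⟨c, x, fun d y => ?_, fun d f hf z hz => ?_⟩
  · obtain ⟨g, hg⟩ := R.standardMk_surjective c d (LeftModules.app e.hom d (LeftModules.app p d y))
    obtain ⟨f, hf, hfg⟩ := R.exists_plus_sub_mem_idealLT g
    have hy : LeftModules.app p d y = LeftModules.app e.inv d (R.standardMk c f) := by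
      rw [← (R.standardMk_eq_iff).2 hfg, hg, LeftModules.app_inv_hom]
    obtain ⟨z, hz⟩ := LeftModules.mem_range_of_isColimit_cokernelCofork h
      (x := y - B.act f x) (by rw [map_sub, hpx, hy, sub_self])
    exact ⟨f, hf, z, by rw [hz, add_sub_cancel]⟩
  · have h1 : LeftModules.app p d (B.act f x) = 0 := by
      rw [← hz, ← LeftModules.app_comp, w, LeftModules.app_zero]
    have h2 : R.standardMk c f = R.standardMk c 0 := by
      rw [← LeftModules.app_hom_inv e d (R.standardMk c f), ← hpx, h1, map_zero]
      rfl
    refine R.eq_zero_of_mem_plus_of_mem_idealLT hf ?_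
    simpa using R.standardMk_eq_iff.1 h2

/-- A module filtered by standard modules is free over `C⁺`, one basis element for each step of
the filtration. -/
theorem exists_isPlusBasis_of_chain {σ : Ordinal.{u}} {F : Set.Iic σ ⥤ LeftModules k C}
    [F.IsWellOrderContinuous] (h0 : IsZero (F.obj ⟨0, Set.mem_Iic.2 zero_le⟩))
    (hF : ∀ (α : Ordinal.{u}) (hα : α < σ),
      let i : F.obj ⟨α, hα.le⟩ ⟶ F.obj ⟨Order.succ α, Order.succ_le_of_lt hα⟩ :=
        F.map (homOfLE (Order.le_succ α))
      Mono i ∧ ∃ (Q : LeftModules k C)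
        (p : F.obj ⟨Order.succ α, Order.succ_le_of_lt hα⟩ ⟶ Q) (w : i ≫ p = 0),
        R.standards Q ∧ Nonempty (IsColimit (CokernelCofork.ofπ p w))) :
    ∃ (c : Set.Iio σ → C) (x : ∀ l, (F.obj ⟨σ, le_refl σ⟩).obj.obj (c l)),
      R.IsPlusBasis (F.obj ⟨σ, le_refl σ⟩) c x := by
  choose hmono Q p w hQ hcoker using hF
  have hgen := fun α : Set.Iio σ =>
    R.exists_generator_of_isColimit (hQ α.1 α.2) (hcoker α.1 α.2).some
  choose c x hspan hind using hgen
  have hsucc : ∀ l : Set.Iio σ, Order.succ l.1 ≤ σ := fun l => Order.succ_le_of_lt l.2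
  have hle : ∀ l : Set.Iio σ, l.1 ≤ σ := fun l => le_of_lt l.2
  let X : ∀ l, (F.obj ⟨σ, le_refl σ⟩).obj.obj (c l) := fun l => LeftModules.app
    (F.map (homOfLE (hsucc l) :
      (⟨Order.succ l.1, hsucc l⟩ : Set.Iic σ) ⟶ ⟨σ, le_refl σ⟩)) (c l) (x l)
  refine ⟨c, X, fun d => ⟨?_, plusMap_surjective_iff.2 ?_⟩⟩
  · refine plusMap_injective_of_linearOrder
      (fun j => LinearMap.range (LeftModules.app
        (F.map (homOfLE (hle j) : (⟨j.1, hle j⟩ : Set.Iic σ) ⟶ ⟨σ, le_refl σ⟩)) d)) ?_ ?_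
    · intro i j hij h hh
      have hij' : Order.succ i.1 ≤ j.1 := Order.succ_le_of_lt hij
      refine ⟨LeftModules.app (F.map (homOfLE hij' :
        (⟨Order.succ i.1, hsucc i⟩ : Set.Iic σ) ⟶ ⟨j.1, hle j⟩)) d ((F.obj _).act h (x i)),
        ?_⟩
      rw [LeftModules.app_map_map F _ _ (homOfLE (hsucc i)), LeftModules.app_act]
    · rintro j h hh ⟨z, hz⟩
      refine hind j d h hh z (LeftModules.app_map_injective hmono (hsucc j) le_rfl d ?_)
      rw [LeftModules.app_map_map F _ _ (homOfLE (hle j)), hz, LeftModules.app_act]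
  · have key : ∀ (β : Ordinal.{u}) (hβ : β ≤ σ) (y : (F.obj ⟨β, hβ⟩).obj.obj d),
        LeftModules.app (F.map (homOfLE hβ : _ ⟶ (⟨σ, le_refl σ⟩ : Set.Iic σ))) d y ∈
          R.plusSpan _ c X d := by
      intro β
      induction β using WellFoundedLT.induction with
      | ind β ih =>
      intro hβ y
      obtain rfl | ⟨γ, rfl⟩ | hlim := Ordinal.zero_or_succ_or_isSuccLimit β
      · have : y = 0 := congrArg (fun φ => LeftModules.app φ d y) (h0.eq_of_src (𝟙 _) 0)
        rw [this, map_zero]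
        exact zero_mem _
      · have hγ : γ < σ := Order.succ_le_iff.1 hβ
        obtain ⟨f, hf, z, rfl⟩ := hspan ⟨γ, hγ⟩ d y
        rw [map_add, LeftModules.app_act, LeftModules.app_map_map F _ _ (homOfLE hγ.le)]
        exact add_mem (act_mem_plusSpan (x := X) ⟨γ, hγ⟩ hf) (ih γ (Order.lt_succ γ) hγ.le z)
      · obtain ⟨α, hα, z, rfl⟩ := LeftModules.exists_app_map_eq_of_isSuccLimit hβ hlim y
        rw [LeftModules.app_map_map F _ _ (homOfLE (hα.le.trans hβ))]
        exact ih α hα _ z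
    rw [eq_top_iff]
    intro y _
    have hy := key σ le_rfl y
    have h1 : LeftModules.app (F.map (homOfLE (le_refl σ) : _ ⟶ (⟨σ, le_refl σ⟩ : Set.Iic σ))) d y
        = y := congrArg (fun φ => LeftModules.app φ d y) (F.map_id _)
    rwa [h1] at hy

theorem liftsFunctionals_of_isFilteredBy {M : LeftModules k C} (hM : IsFilteredBy R.standards M) :
    R.LiftsFunctionals M := by
  obtain ⟨σ, F, hcont, h0, ⟨e⟩, hF⟩ := hM
  obtain ⟨c, x, hx⟩ := R.exists_isPlusBasis_of_chain h0 hF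
  exact hx.liftsFunctionals.of_retract e.inv e.hom e.inv_hom_id

/-! ### Modules free over the direct subcategory are filtered -/

section

open LeftModules

/-- The map `Δ_c → B` sending the generator to an element killed by `I_{<deg c}`. -/
noncomputable def standardDesc {B : LeftModules k C} {c : C} (x : B.obj.obj c)
    (hx : ∀ d, ∀ f ∈ R.idealLT (R.deg c) c d, B.act f x = 0) : R.standard c ⟶ B :=
  mkHom (fun d => (R.idealLT (R.deg c) c d).liftQ (B.act.flip x) fun f hf => hx d f hf) <| by
    intro d d' g z
    obtain ⟨f, rfl⟩ := R.standardMk_surjective c d z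
    exact B.act_comp f g x

theorem app_standardDesc {B : LeftModules k C} {c : C} (x : B.obj.obj c)
    (hx : ∀ d, ∀ f ∈ R.idealLT (R.deg c) c d, B.act f x = 0) {d : C} (f : c ⟶ d) :
    app (R.standardDesc x hx) d (R.standardMk c f) = B.act f x := rfl

/-- If `B` is generated freely over `C⁺` by an element `x`, modulo the image of `i : A ⟶ B`, and
`I_{<deg c}` carries `x` into this image, then the cokernel of `i` is a standard module. -/
theorem exists_cokernel_of_generator {A B : LeftModules k C} (i : A ⟶ B) {c : C}
    (x : B.obj.obj c)
    (hker : ∀ d, ∀ f ∈ R.idealLT (R.deg c) c d, ∃ z, app i d z = B.act f x)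
    (hspan : ∀ (d : C) (y : B.obj.obj d), ∃ f ∈ R.plus.hom c d, ∃ z : A.obj.obj d,
      y = B.act f x + app i d z)
    (hind : ∀ (d : C), ∀ f ∈ R.plus.hom c d, ∀ z : A.obj.obj d,
      app i d z = B.act f x → f = 0) :
    ∃ (Q : LeftModules k C) (p : B ⟶ Q) (w : i ≫ p = 0),
      R.standards Q ∧ Nonempty (IsColimit (CokernelCofork.ofπ p w)) := by
  let T := Sub.range i
  have hTi : ∀ d (z : A.obj.obj d), app T.mkQ d (app i d z) = 0 := fun d z =>
    T.app_mkQ_eq_zero_iff.2 ⟨z, rfl⟩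
  have hact : ∀ {d : C} (f : c ⟶ d), T.quotient.act f (app T.mkQ c x) = app T.mkQ d (B.act f x) :=
    fun f => (app_act T.mkQ f x).symm
  have hdesc : ∀ d, ∀ f ∈ R.idealLT (R.deg c) c d, T.quotient.act f (app T.mkQ c x) = 0 := by
    intro d f hf
    obtain ⟨z, hz⟩ := hker d f hf
    rw [hact, ← hz, hTi]
  refine ⟨T.quotient, T.mkQ, hom_ext_app hTi, ⟨c, ?_⟩, nonempty_isColimit_cokernelCofork _
    T.app_mkQ_surjective fun d x hx => T.app_mkQ_eq_zero_iff.1 hx⟩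
  obtain ⟨e⟩ := nonempty_iso_of_bijective (R.standardDesc _ hdesc) fun d => by
    constructor
    · rw [injective_iff_map_eq_zero]
      intro u hu
      obtain ⟨f, rfl⟩ := R.standardMk_surjective c d u
      rw [app_standardDesc, hact, T.app_mkQ_eq_zero_iff] at hu
      obtain ⟨z, hz⟩ := hu
      obtain ⟨h, hh, hfh⟩ := R.exists_plus_sub_mem_idealLT f
      obtain ⟨z', hz'⟩ := hker d _ hfh
      have h0 : h = 0 := hind d h hh (z - z') (by
        rw [map_sub, hz, hz', map_sub, LinearMap.sub_apply, sub_sub_cancel])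
      refine (R.standardMk_eq_iff (g := 0)).2 ?_
      rwa [h0] at hfh
    · intro u
      obtain ⟨y, rfl⟩ := T.app_mkQ_surjective d u
      obtain ⟨f, -, z, rfl⟩ := hspan d y
      refine ⟨R.standardMk c f, ?_⟩
      rw [app_standardDesc, hact, map_add, hTi, add_zero]
  exact ⟨e.symm⟩

variable {R}

variable {N : LeftModules k C} {J : Type u} {c : J → C} {y : ∀ j, N.obj.obj (c j)}

variable (R) in
/-- The span under `C⁺` of the elements `y j` of rank less than `α`. -/
def rankSpan (c : J → C) (y : ∀ j, N.obj.obj (c j)) (ρ : J → Ordinal.{u}) (α : Ordinal.{u})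
    (d : C) : Submodule k (N.obj.obj d) :=
  R.plusSpan N (fun l : {j // ρ j < α} => c l.1) (fun l => y l.1) d

section

variable {ρ : J → Ordinal.{u}}

theorem act_mem_rankSpan {α : Ordinal.{u}} {j : J} (hj : ρ j < α) {d : C} {h : c j ⟶ d}
    (hh : h ∈ R.plus.hom (c j) d) : N.act h (y j) ∈ R.rankSpan c y ρ α d :=
  act_mem_plusSpan (x := fun l : {j // ρ j < α} => y l.1) ⟨j, hj⟩ hh

theorem rankSpan_mono (d : C) : Monotone fun α => R.rankSpan c y ρ α d := by
  intro α β hαβ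
  refine Submodule.span_mono ?_
  rintro _ ⟨l, h, hh, rfl⟩
  exact ⟨⟨l.1, l.2.trans_le hαβ⟩, h, hh, rfl⟩

theorem exists_mem_rankSpan_of_isSuccLimit {β : Ordinal.{u}} (hβ : Order.IsSuccLimit β) {d : C}
    {x : N.obj.obj d} (hx : x ∈ R.rankSpan c y ρ β d) :
    ∃ α < β, x ∈ R.rankSpan c y ρ α d := by
  induction hx using Submodule.span_induction with
  | zero => exact ⟨0, pos_iff_ne_zero.2 hβ.ne_bot, zero_mem _⟩
  | add x z _ _ hx hz =>
    obtain ⟨α, hα, hx⟩ := hx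
    obtain ⟨γ, hγ, hz⟩ := hz
    exact ⟨max α γ, max_lt hα hγ, add_mem (rankSpan_mono d (le_max_left _ _) hx)
      (rankSpan_mono d (le_max_right _ _) hz)⟩
  | smul a x _ hx =>
    obtain ⟨α, hα, hx⟩ := hx
    exact ⟨α, hα, Submodule.smul_mem _ a hx⟩
  | mem x hx =>
    obtain ⟨l, h, hh, rfl⟩ := hx
    exact ⟨Order.succ (ρ l.1), hβ.succ_lt l.2, act_mem_rankSpan (Order.lt_succ _) hh⟩

theorem exists_of_mem_rankSpan_succ (hρ : Function.Injective ρ) (j : J) {d : C}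
    {x : N.obj.obj d} (hx : x ∈ R.rankSpan c y ρ (Order.succ (ρ j)) d) :
    ∃ h ∈ R.plus.hom (c j) d, ∃ z ∈ R.rankSpan c y ρ (ρ j) d, x = N.act h (y j) + z := by
  induction hx using Submodule.span_induction with
  | zero => exact ⟨0, zero_mem _, 0, zero_mem _, by simp⟩
  | add x x' _ _ hx hx' =>
    obtain ⟨h, hh, z, hz, rfl⟩ := hx
    obtain ⟨h', hh', z', hz', rfl⟩ := hx'
    refine ⟨h + h', add_mem hh hh', z + z', add_mem hz hz', ?_⟩
    rw [map_add, LinearMap.add_apply, add_add_add_comm]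
  | smul a x _ hx =>
    obtain ⟨h, hh, z, hz, rfl⟩ := hx
    exact ⟨a • h, Submodule.smul_mem _ a hh, a • z, Submodule.smul_mem _ a hz, by simp⟩
  | mem x hx =>
    obtain ⟨⟨l, hl⟩, h, hh, rfl⟩ := hx
    obtain hlj | hlj := (Order.lt_succ_iff.1 hl).eq_or_lt
    · obtain rfl := hρ hlj
      exact ⟨h, hh, 0, zero_mem _, by simp⟩
    · exact ⟨0, zero_mem _, _, act_mem_rankSpan hlj hh, by simp⟩

theorem IsPlusBasis.eq_zero_of_act_mem_rankSpan (hy : R.IsPlusBasis N c y) (j : J) {d : C}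
    {h : c j ⟶ d} (hh : h ∈ R.plus.hom (c j) d) (hj : N.act h (y j) ∈ R.rankSpan c y ρ (ρ j) d) :
    h = 0 := by
  classical
  have hle : R.rankSpan c y ρ (ρ j) d ≤
      (LinearMap.ker (DFinsupp.lapply (R := k) (M := fun l => R.plus.hom (c l) d) j)).map
        (R.plusMap N c y d) := by
    rw [rankSpan, plusSpan, Submodule.span_le]
    rintro _ ⟨⟨l, hl⟩, g, hg, rfl⟩
    refine ⟨DFinsupp.single l ⟨g, hg⟩, ?_, plusMap_single l _⟩
    have hlj : j ≠ l := by rintro rfl; exact lt_irrefl _ hl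
    exact DFinsupp.single_eq_of_ne hlj
  obtain ⟨v, hv, hvh⟩ := hle hj
  rw [← plusMap_single j ⟨h, hh⟩] at hvh
  have hvj : v j = 0 := hv
  rw [(hy d).1 hvh, DFinsupp.single_eq_same] at hvj
  exact congrArg Subtype.val hvj

/-- `I_{<deg c}` carries the basis element `y j` at `c = c j` into the span of the basis elements
of smaller degree: it factors through objects `e` of smaller degree, and `C⁺(-,e)` vanishes on
objects of degree larger than `deg e`. -/
theorem IsPlusBasis.act_mem_rankSpan_of_mem_idealLT (hy : R.IsPlusBasis N c y)
    (hdeg : ∀ i j, R.deg (c i) < R.deg (c j) → ρ i < ρ j) (j : J) {d : C} {f : c j ⟶ d}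
    (hf : f ∈ R.idealLT (R.deg (c j)) (c j) d) : N.act f (y j) ∈ R.rankSpan c y ρ (ρ j) d := by
  rw [idealLT_eq_span] at hf
  induction hf using Submodule.span_induction with
  | zero => rw [map_zero]; exact zero_mem _
  | add f g _ _ hf hg => rw [map_add]; exact add_mem hf hg
  | smul a f _ hf => rw [map_smul]; exact Submodule.smul_mem _ a hf
  | mem f hf =>
    obtain ⟨e, he, g, -, h, hh, rfl⟩ := hf
    rw [N.act_comp]
    have hle : R.plusSpan N c y e ≤ R.rankSpan c y ρ (ρ j) e := by
      rw [plusSpan, Submodule.span_le]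
      rintro _ ⟨l, h', hh', rfl⟩
      by_cases h0 : h' = 0
      · rw [h0, map_zero]
        exact zero_mem _
      · refine act_mem_rankSpan (hdeg l j (lt_of_le_of_lt ?_ he)) hh'
        by_cases hle : c l = e
        · rw [hle]
        · exact (R.plus_isDirect.deg_lt_deg h' hh' h0 hle).le
    refine act_mem_plusSpan_of_mem hh (hle ?_)
    rw [hy.plusSpan_eq_top]
    trivial

theorem IsPlusBasis.act_mem_rankSpan_of_mem (hy : R.IsPlusBasis N c y)
    (hdeg : ∀ i j, R.deg (c i) < R.deg (c j) → ρ i < ρ j) {α : Ordinal.{u}} {d d' : C}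
    (f : d ⟶ d') {x : N.obj.obj d} (hx : x ∈ R.rankSpan c y ρ α d) :
    N.act f x ∈ R.rankSpan c y ρ α d' := by
  induction hx using Submodule.span_induction with
  | zero => rw [map_zero]; exact zero_mem _
  | add f g _ _ hf hg => rw [map_add]; exact add_mem hf hg
  | smul a f _ hf => rw [map_smul]; exact Submodule.smul_mem _ a hf
  | mem x hx =>
    obtain ⟨⟨l, hl⟩, h, hh, rfl⟩ := hx
    rw [← N.act_comp]
    -- Split `h ≫ f` along `C(c l,d') = C⁺(c l,d') + I_{<deg (c l)}(c l,d')`.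
    obtain ⟨g, hg, hgf⟩ := R.exists_plus_sub_mem_idealLT (h ≫ f)
    rw [← add_sub_cancel g (h ≫ f), map_add, LinearMap.add_apply]
    exact add_mem (act_mem_rankSpan hl hg) (rankSpan_mono d' hl.le
      (hy.act_mem_rankSpan_of_mem_idealLT hdeg l hgf))

end

/-- A module that is free over `C⁺` is filtered by standard modules: adjoin the basis elements
one by one, in order of increasing degree. -/
theorem IsPlusBasis.isFilteredBy (hy : R.IsPlusBasis N c y) : IsFilteredBy R.standards N := by
  obtain ⟨σ, ρ, hρ, hσ, hsurj, hdeg⟩ := Ordinal.exists_rank fun j => R.deg (c j)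
  let S : Ordinal.{u} → Sub N := fun α =>
    ⟨R.rankSpan c y ρ α, fun f _ hx => hy.act_mem_rankSpan_of_mem hdeg f hx⟩
  have hS : ∀ d, Monotone fun α => (S α).carrier d := rankSpan_mono
  refine ⟨σ, Sub.chain σ S hS, Sub.chain_isWellOrderContinuous hS
    fun β hβ d x hx => exists_mem_rankSpan_of_isSuccLimit hβ hx, ?_, ?_, ?_⟩
  · rw [IsZero.iff_id_eq_zero]
    refine hom_ext_app fun d x => ?_
    have hbot : (S 0).carrier d ≤ ⊥ := by
      refine Submodule.span_le.2 ?_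
      rintro _ ⟨⟨l, hl⟩, -⟩
      exact absurd hl not_lt_zero
    exact Subtype.ext ((Submodule.mem_bot k).1
      (hbot (Subtype.property (p := (· ∈ (S 0).carrier d)) x)))
  · refine nonempty_iso_of_bijective (S σ).subtype fun d =>
      ⟨Subtype.val_injective, fun x => ⟨⟨x, ?_⟩, rfl⟩⟩
    have hx : x ∈ R.plusSpan N c y d := by rw [hy.plusSpan_eq_top]; trivial
    refine Submodule.span_mono ?_ hx
    rintro _ ⟨l, h, hh, rfl⟩
    exact ⟨⟨l, hσ l⟩, h, hh, rfl⟩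
  · intro α hα i
    obtain ⟨j, rfl⟩ := hsurj α hα
    refine ⟨mono_of_app_injective _ fun d => Submodule.inclusion_injective (hS d (Order.le_succ _)),
      ?_⟩
    have hyj : y j ∈ (S (Order.succ (ρ j))).carrier (c j) := by
      have := act_mem_rankSpan (R := R) (y := y) (Order.lt_succ (ρ j)) (R.plus.id_mem (c j))
      rwa [N.act_id] at this
    refine R.exists_cokernel_of_generator i (c := c j)
      (⟨y j, hyj⟩ : (S (Order.succ (ρ j))).carrier (c j)) (fun d f hf => ?_) (fun d x => ?_)
      fun d f hf z hz => ?_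
    · exact ⟨(⟨_, hy.act_mem_rankSpan_of_mem_idealLT hdeg j hf⟩ : (S (ρ j)).carrier d), rfl⟩
    · obtain ⟨x, hx⟩ := (x : (S (Order.succ (ρ j))).carrier d)
      obtain ⟨h, hh, z, hz, rfl⟩ := exists_of_mem_rankSpan_succ hρ j hx
      exact ⟨h, hh, (⟨z, hz⟩ : (S (ρ j)).carrier d), rfl⟩
    · refine hy.eq_zero_of_act_mem_rankSpan (ρ := ρ) j hf ?_
      obtain ⟨z, hz'⟩ := (z : (S (ρ j)).carrier d)
      have : z = N.act f (y j) := congrArg Subtype.val hz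
      exact this ▸ hz'

end

end LinearReedyStructure

theorem mainTheorem8 {k : Type u} [Field k] {C : Type u} [SmallCategory C]
    [Preadditive C] [Linear k C] (R : LinearReedyStructure k C)
    (M N : LeftModules k C) (hM : IsFilteredBy R.standards M) (hN : IsDirectSummand N M) :
    IsFilteredBy R.standards N := by
  obtain ⟨N', b, -, ⟨e⟩⟩ := hN
  have hL : R.LiftsFunctionals N :=
    (R.liftsFunctionals_of_isFilteredBy hM).of_retract (b.inl ≫ e.hom) (e.inv ≫ b.fst) (by simp)
  obtain ⟨J, c, y, hy⟩ := hL.exists_isPlusBasis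
  exact hy.isFilteredBy
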